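/- Let $k$ be a perfect field of characteristic $p>0$ with algebraic closure $\overline{k}$, let $n<p$, and let $\mathcal{Y}\subset\mathbb{P}^n(\overline{k})$ be an irreducible projective curve defined over $k$ and contained in no hyperplane. Let $k(\mathcal{Y})\subset\overline{k}(\mathcal{Y})$ be its function fields over $k$ and over $\overline{k}$, and let $\tilde{\mathcal{Y}}$ be a nonsingular model of $\mathcal{Y}$, whose points $P$ are identified with the discrete valuation rings of $\overline{k}(\mathcal{Y})$ containing $\overline{k}$. Let $y_0,\dots,y_n\in k(\mathcal{Y})$ be coordinate functions of $\mathcal{Y}$, i.e. functions, not all zero, such that $(y_0:\cdots:y_n)$ is the inclusion of $\mathcal{Y}$ in $\mathbb{P}^n$. For $P\in\tilde{\mathcal{Y}}$ and a hyperplane $H:\sum_k a_kY_k=0$, let $$I(P,\mathcal{Y}\cap H)=v_P\Big(\sum_{k} a_k y_k\Big)-\min_{k} v_P(y_k)$$ be the intersection multiplicity of $\mathcal{Y}$ and $H$ at $P$. Let $r>0$ be an integer and let $u_0,\dots,u_n\in k(\mathcal{Y})$, not all zero, satisfy $$u_0^{p^r}y_0+u_1^{p^r}y_1+\cdots+u_n^{p^r}y_n=0.$$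 Then, for all but finitely many points $P\in\tilde{\mathcal{Y}}$, the functions $u_0,\dots,u_n$ are regular and not all zero at $P$, the hyperplane $$H^r_P:\ u_0(P)^{p^r}Y_0+u_1(P)^{p^r}Y_1+\cdots+u_n(P)^{p^r}Y_n=0$$ satisfies $I(P,\mathcal{Y}\cap H^r_P)\ge p^r$, and, for every separating element $\zeta$ of $k(\mathcal{Y})/k$, $$I(P,\mathcal{Y}\cap H^r_P)=p^r\iff \big(D^{(1)}_\zeta u_0\big)^{p^r}y_0+\big(D^{(1)}_\zeta u_1\big)^{p^r}y_1+\cdots+\big(D^{(1)}_\zeta u_n\big)^{p^r}y_n\neq 0.$$ Here $\zeta$ is separating if it is transcendental over $k$ and $k(\mathcal{Y})$ is separable algebraic over $k(\zeta)$, and $D^{(1)}_\zeta$ is the first Hasse derivative with respect to $\zeta$, i.e. the unique $k$-derivation of $k(\mathcal{Y})$ with $D^{(1)}_\zeta\zeta=1$. -/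

import Mathlib

open scoped LinearAlgebra.Projectivization

noncomputable section

/-! ### Separating elements and the first Hasse derivative -/

/-- `ζ` is a separating element of the field extension `E / F`: it is transcendental over `F` and
`E` is separable algebraic over `F(ζ)`. -/
structure IsSeparatingElement (F : Type*) {E : Type*} [Field F] [Field E] [Algebra F E]
    (ζ : E) : Prop where
  transcendental : Transcendental F ζ
  isSeparable : Algebra.IsSeparable (IntermediateField.adjoin F {ζ}) E

open scoped IntermediateField.algebraAdjoinAdjoin in
theorem IsSeparatingElement.existsUnique_derivation {F E : Type*} [Field F] [Field E]
    [Algebra F E] {ζ : E} (hζ : IsSeparatingElement F ζ) :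
    ∃! D : Derivation F E E, D ζ = 1 := by
  let _ : Algebra (Polynomial F) E := (Polynomial.aeval ζ).toAlgebra
  have hX : algebraMap (Polynomial F) E Polynomial.X = ζ := Polynomial.aeval_X ζ
  let g : Polynomial F →ₐ[F] Algebra.adjoin F {ζ} :=
    Polynomial.aeval ⟨ζ, Algebra.self_mem_adjoin_singleton F ζ⟩
  have hg : ∀ q, (g q : E) = Polynomial.aeval ζ q := fun q =>
    (Polynomial.aeval_algHom_apply (Algebra.adjoin F {ζ}).val
      (⟨ζ, Algebra.self_mem_adjoin_singleton F ζ⟩ : Algebra.adjoin F {ζ}) q).symm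
  let _ : Algebra (Polynomial F) (Algebra.adjoin F {ζ}) := g.toAlgebra
  have _ : IsScalarTower F (Polynomial F) E :=
    IsScalarTower.of_algebraMap_eq fun a => ((Polynomial.aeval ζ).commutes a).symm
  have _ : IsScalarTower (Polynomial F) (Algebra.adjoin F {ζ}) E :=
    IsScalarTower.of_algebraMap_eq fun a => (hg a).symm
  have hbij : Function.Bijective (algebraMap (Polynomial F) (Algebra.adjoin F {ζ})) := by
    constructor
    · intro a b hab
      have : Polynomial.aeval ζ a = Polynomial.aeval ζ b := by
        rw [← hg, ← hg]; exact congrArg _ hab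
      exact transcendental_iff_injective.mp hζ.transcendental this
    · rintro ⟨x, hx⟩
      have hx' := hx
      rw [Algebra.adjoin_singleton_eq_range_aeval] at hx'
      obtain ⟨q, hq⟩ := hx'
      exact ⟨q, Subtype.ext ((hg q).trans hq)⟩
  have _ : Algebra.FormallyEtale (Polynomial F) (Algebra.adjoin F {ζ}) :=
    .of_equiv (AlgEquiv.ofBijective (Algebra.ofId (Polynomial F) _) hbij)
  have _ : Algebra.FormallyEtale (Algebra.adjoin F {ζ}) (IntermediateField.adjoin F {ζ}) :=
    .of_isLocalization (nonZeroDivisors _)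
  have _ : Algebra.IsSeparable (IntermediateField.adjoin F {ζ}) E := hζ.isSeparable
  have _ : Algebra.FormallyEtale (IntermediateField.adjoin F {ζ}) E := .of_isSeparable _ _
  have _ : Algebra.FormallyEtale (Algebra.adjoin F {ζ}) E :=
    .comp _ (IntermediateField.adjoin F {ζ}) E
  have _ : Algebra.FormallyEtale (Polynomial F) E := .comp _ (Algebra.adjoin F {ζ}) E
  let e := KaehlerDifferential.tensorKaehlerEquivOfFormallyEtale F (Polynomial F) E
  let D₀ : Derivation F (Polynomial F) E := Polynomial.mkDerivation F (1 : E)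
  have hb := TensorProduct.isBaseChange (Polynomial F) (Ω[Polynomial F⁄F]) E
  refine existsUnique_of_exists_of_unique
    ⟨((hb.lift D₀.liftKaehlerDifferential).comp e.symm.toLinearMap).compDer
      (KaehlerDifferential.D F E), ?_⟩ ?_
  · change hb.lift D₀.liftKaehlerDifferential (e.symm (KaehlerDifferential.D F E ζ)) = 1
    rw [← hX, KaehlerDifferential.tensorKaehlerEquivOfFormallyEtale_symm_D_algebraMap]
    refine (hb.lift_eq D₀.liftKaehlerDifferential
      (KaehlerDifferential.D F (Polynomial F) Polynomial.X)).trans ?_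
    rw [Derivation.liftKaehlerDifferential_comp_D]
    exact Polynomial.mkDerivation_X F (1 : E)
  · intro D D' hD hD'
    have h1 : D.compAlgebraMap (Polynomial F) = D'.compAlgebraMap (Polynomial F) :=
      Polynomial.derivation_ext (by
        change D (algebraMap (Polynomial F) E Polynomial.X) =
          D' (algebraMap (Polynomial F) E Polynomial.X)
        rw [hX, hD, hD'])
    have h2 : D.liftKaehlerDifferential ∘ₗ e.toLinearMap =
        D'.liftKaehlerDifferential ∘ₗ e.toLinearMap := by
      apply hb.algHom_ext
      intro ω
      have hω : ω ∈ Submodule.span (Polynomial F)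
          (Set.range (KaehlerDifferential.D F (Polynomial F))) := by
        rw [KaehlerDifferential.span_range_derivation]; trivial
      induction hω using Submodule.span_induction with
      | mem _ h =>
        obtain ⟨q, rfl⟩ := h
        simpa [e] using DFunLike.congr_fun h1 q
      | zero => simp
      | add a b _ _ ha hb => simp only [map_add, ha, hb]
      | smul c a _ ha =>
        rw [map_smul, ← algebraMap_smul E c, map_smul, map_smul, ha]
    ext x
    have h3 := LinearMap.congr_fun h2 (e.symm (KaehlerDifferential.D F E x))
    simpa using h3

/-- The first Hasse derivative `D_ζ^{(1)}` on `E` with respect to the separating element `ζ`: the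
unique `F`-derivation of `E` taking the value `1` at `ζ`. -/
def IsSeparatingElement.hasseDeriv {F E : Type*} [Field F] [Field E] [Algebra F E] {ζ : E}
    (hζ : IsSeparatingElement F ζ) : Derivation F E E :=
  hζ.existsUnique_derivation.choose

/-! ### Projective varieties and curves over an algebraically closed field -/

/-- The affine cone (without its vertex) over a set of points of `ℙⁿ(K)`. -/
def puncturedCone {K : Type*} [Field K] {n : ℕ} (Y : Set (ℙ K (Fin (n + 1) → K))) :
    Set (Fin (n + 1) → K) :=
  {v | ∃ hv : v ≠ 0, Projectivization.mk K v hv ∈ Y}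

/-- The homogeneous ideal of a set of points of `ℙⁿ(K)` (with `K` infinite): the polynomials
vanishing at all the homogeneous coordinate vectors of all the points. -/
def projIdeal {K : Type*} [Field K] {n : ℕ} (Y : Set (ℙ K (Fin (n + 1) → K))) :
    Ideal (MvPolynomial (Fin (n + 1)) K) :=
  MvPolynomial.vanishingIdeal K (puncturedCone Y)

/-- An irreducible closed subset of `ℙⁿ(K)`, `K` an algebraically closed field. -/
structure ProjVariety (K : Type*) [Field K] (n : ℕ) where
  carrier : Set (ℙ K (Fin (n + 1) → K))
  /-- `carrier` is the common zero set of a set of homogeneous polynomials. -/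
  isClosed : ∃ T : Set (MvPolynomial (Fin (n + 1)) K), (∀ f ∈ T, ∃ d, f.IsHomogeneous d) ∧
    ∀ P, P ∈ carrier ↔ ∀ f ∈ T, MvPolynomial.eval P.rep f = 0
  isPrime : (projIdeal carrier).IsPrime

namespace ProjVariety

variable {K : Type*} [Field K] {n : ℕ} (Y : ProjVariety K n)

instance : (projIdeal Y.carrier).IsPrime := Y.isPrime

/-- The homogeneous coordinate ring `K[Y₀, …, Yₙ] / I(Y)`. -/
abbrev CoordinateRing : Type _ := MvPolynomial (Fin (n + 1)) K ⧸ projIdeal Y.carrier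

/-- The fraction field of the homogeneous coordinate ring (the function field of the cone). -/
abbrev ConeField : Type _ := FractionRing Y.CoordinateRing

/-- The class of the homogeneous coordinate `Yᵢ`. -/
def coord (i : Fin (n + 1)) : Y.ConeField :=
  algebraMap Y.CoordinateRing Y.ConeField
    (Ideal.Quotient.mk (projIdeal Y.carrier) (MvPolynomial.X i))

/-- The function field `F(Y)` for a subfield `F` of `K`: it is generated over `F` by the ratios
`Yᵢ / Yⱼ` of the homogeneous coordinates. For `F = K` it is the field of all
quotients of homogeneous elements of the same degree of the coordinate ring. -/
def functionField (F : Type*) [Field F] [Algebra F K] : IntermediateField F Y.ConeField :=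
  IntermediateField.adjoin F {f | ∃ i j, f = Y.coord i / Y.coord j}

/-- The rational function `Yᵢ / Yⱼ` (for `Yⱼ` not identically zero on `Y`). -/
def ratio (i j : Fin (n + 1)) : Y.functionField K :=
  ⟨Y.coord i / Y.coord j, IntermediateField.subset_adjoin _ _ ⟨i, j, rfl⟩⟩

/-- The inclusion `F(Y) ⊆ K(Y)`. -/
def incl (F : Type*) [Field F] [Algebra F K] : Y.functionField F →ₐ[F] Y.functionField K :=
  IntermediateField.inclusion (F := (Y.functionField K).restrictScalars F)
    (IntermediateField.adjoin_le_iff.mpr (IntermediateField.subset_adjoin K _))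

/-- `Y` is defined over the subfield `F`: its ideal is generated by polynomials over `F`. -/
def IsDefinedOver (F : Type*) [Field F] [Algebra F K] : Prop :=
  ∃ T : Set (MvPolynomial (Fin (n + 1)) F),
    projIdeal Y.carrier = Ideal.span (MvPolynomial.map (algebraMap F K) '' T)

/-- `Y` is contained in no hyperplane. -/
def IsNondegenerate : Prop :=
  ∀ a : Fin (n + 1) → K, a ≠ 0 → ∃ P ∈ Y.carrier, ∑ i, a i * P.rep i ≠ 0

/-- `y₀, …, yₙ ∈ F(Y)` are coordinate functions of `Y`: they are not all zero and
`(y₀ : … : yₙ) = (Y₀ : … : Yₙ)` on `Y`. -/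
def IsCoordinateFunctions {F : Type*} [Field F] [Algebra F K]
    (y : Fin (n + 1) → Y.functionField F) : Prop :=
  y ≠ 0 ∧ ∀ i j, (y i : Y.ConeField) * Y.coord j = (y j : Y.ConeField) * Y.coord i

theorem exists_coord_ne_zero : ∃ j, Y.coord j ≠ 0 := by
  by_contra! h
  apply Y.isPrime.ne_top
  have hc : puncturedCone Y.carrier = ∅ := by
    rw [Set.eq_empty_iff_forall_notMem]
    intro v hv
    apply hv.1
    funext j
    have hj := h j
    rw [coord, FaithfulSMul.algebraMap_eq_zero_iff, Ideal.Quotient.eq_zero_iff_mem] at hj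
    simpa using hj v hv
  rw [projIdeal, hc, MvPolynomial.vanishingIdeal_empty]

/-- A point of the nonsingular model of a curve `Y`: a discrete valuation ring of
`K(Y)` containing `K`. -/
structure ModelPoint where
  ring : ValuationSubring (Y.functionField K)
  algebraMap_mem : ∀ c : K, algebraMap K (Y.functionField K) c ∈ ring
  isDVR : IsDiscreteValuationRing ring

namespace ModelPoint

variable {Y} (P : Y.ModelPoint)

instance : IsDiscreteValuationRing P.ring := P.isDVR

/-- The rational function `f` is regular at `P` and `f(P) = c`. -/
def HasValue (f : Y.functionField K) (c : K) : Prop :=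
  P.ring.valuation (f - algebraMap K (Y.functionField K) c) < 1

theorem exists_chart : ∃ j, Y.coord j ≠ 0 ∧ ∀ i, Y.ratio i j ∈ P.ring := by
  obtain ⟨j₀, hj₀⟩ := Y.exists_coord_ne_zero
  obtain ⟨j, hj⟩ := Finite.exists_max fun i => P.ring.valuation (Y.ratio i j₀)
  have hjz : Y.coord j ≠ 0 := by
    intro h0
    have h1 : Y.ratio j₀ j₀ = 1 := Subtype.ext (div_self hj₀)
    have h2 : Y.ratio j j₀ = 0 := Subtype.ext (by simp [ratio, h0])
    have := hj j₀
    simp [h1, h2] at this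
  refine ⟨j, hjz, fun i => ?_⟩
  have h3 : Y.ratio i j = Y.ratio i j₀ / Y.ratio j j₀ := Subtype.ext (by
    simp only [ratio, IntermediateField.coe_div]
    field_simp)
  have h4 : Y.ratio j j₀ ≠ 0 := fun h => by
    have := congrArg Subtype.val h
    simp [ratio, hjz, hj₀] at this
  rw [← ValuationSubring.valuation_le_one_iff, h3, map_div₀]
  exact div_le_one_of_le₀ (hj i) zero_le

/-- An index `j` such that the point of `Y` below `P` lies in the affine chart `Yⱼ ≠ 0`. -/
def chart : Fin (n + 1) := P.exists_chart.choose

/-- The local equation at `P` of the hyperplane `∑ aᵢ Yᵢ = 0`: the regular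
function `∑ aᵢ Yᵢ / Yⱼ`, where the point of `Y` below `P` lies in the chart `Yⱼ ≠ 0`. -/
def localEquation (a : Fin (n + 1) → K) : P.ring :=
  ∑ i, ⟨algebraMap K _ (a i), P.algebraMap_mem (a i)⟩ *
    ⟨Y.ratio i P.chart, P.exists_chart.choose_spec.2 i⟩

/-- The intersection multiplicity at `P` of `Y` and the hyperplane `∑ aᵢ Yᵢ = 0`: the order of
vanishing at `P` of the local equation of the hyperplane. -/
def intersectionMultiplicity (a : Fin (n + 1) → K) : ℕ∞ :=
  IsDiscreteValuationRing.addVal P.ring (P.localEquation a)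

end ModelPoint

end ProjVariety

/-- A projective curve in `ℙⁿ(K)`: a projective variety of dimension one. -/
structure ProjCurve (K : Type*) [Field K] (n : ℕ) extends ProjVariety K n where
  trdeg_eq_one : Algebra.trdeg K (toProjVariety.functionField K) = 1

end

/-! ### Separating elements -/

section SeparatingElements

variable {F E : Type*} [Field F] [Field E] [Algebra F E]

/-! Put `q = p ^ r`. At a place `P` with affine coordinates `x i = Yᵢ / Yⱼ`, the relation becomes `∑
u i ^ q * x i = 0`. Let `b i` be the value of `u i` at `P`, `t` a uniformizer and `u i - b i = t * c
i`. The `q`-th power map is additive, so `∑ b i ^ q * x i = -t ^ q * ∑ c i ^ q * x i`. The left side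
is the local equation of the hyperplane; hence the multiplicity is at least `q`, with equality iff
`∑ c i ^ q * x i` is a unit at `P`.

If a derivation `D` preserves the valuation ring, kills constants and has `D t = 1`, then `D (u i) =
c i + t * D (c i)`. So `∑ D (u i) ^ q * x i` is congruent to `∑ c i ^ q * x i` modulo the maximal
ideal. Up to the factor `y j` this sum is one fixed function of the curve, which is either zero or a
unit at almost every place.

The rest is finiteness. A nonzero function has finitely many zeros and poles, and a derivation
preserves almost every valuation ring; both follow from the finitely generated Dedekind domain
integral over `F[ζ]`. A single separating element `ξ` serves for all `ζ`, because `D_ζ = D_ζ(ξ) •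
D_ξ`. -/

theorem IsSeparatingElement.inv {ζ : E} (hζ : IsSeparatingElement F ζ) :
    IsSeparatingElement F ζ⁻¹ where
  transcendental h := hζ.transcendental (by simpa using h.inv)
  isSeparable := by
    have h : IntermediateField.adjoin F {ζ⁻¹} = IntermediateField.adjoin F {ζ} := by
      apply le_antisymm <;> rw [IntermediateField.adjoin_simple_le_iff]
      · exact inv_mem (IntermediateField.mem_adjoin_simple_self F ζ)
      · simpa using inv_mem (IntermediateField.mem_adjoin_simple_self F ζ⁻¹)
    rw [h]
    exact hζ.isSeparable

/-- Over a perfect field there is a separating transcendence basis; in transcendence degree one it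
is a single element. -/
theorem exists_isSeparatingElement [PerfectField F] [Algebra.EssFiniteType F E]
    (htr : Algebra.trdeg F E = 1) : ∃ ζ : E, IsSeparatingElement F ζ := by
  obtain ⟨s, hs, hsep⟩ := exists_isTranscendenceBasis_and_isSeparable_of_perfectField F E
  have hcard := hs.cardinalMk_eq_trdeg
  rw [htr, Cardinal.mk_coe_finset, Nat.cast_eq_one, Finset.card_eq_one] at hcard
  obtain ⟨ζ, rfl⟩ := hcard
  refine ⟨ζ, ?_, ?_⟩
  · have : Subsingleton ({ζ} : Finset E) := by
      rw [← Finset.card_le_one_iff_subsingleton_coe]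
      simp
    exact (algebraicIndependent_singleton_iff (⟨ζ, by simp⟩ : ({ζ} : Finset E))).mp hs.1
  · rwa [Finset.coe_singleton] at hsep

theorem isAlgebraic_adjoin_of_transcendental (htr : Algebra.trdeg F E = 1) {f : E}
    (hf : Transcendental F f) : Algebra.IsAlgebraic (IntermediateField.adjoin F {f}) E := by
  have hind : AlgebraicIndependent F (fun _ : PUnit => f) :=
    algebraicIndependent_unique_type_iff.mpr hf
  have := (hind.isTranscendenceBasis_of_trdeg_le_of_finite (by simp [htr])).isAlgebraic_field
  rwa [Set.range_const] at this

/-- A derivation that vanishes at a separating element vanishes. -/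
theorem IsSeparatingElement.derivation_eq_zero {M : Type*} [AddCommGroup M] [Module F M]
    [Module E M] {ζ : E} (hζ : IsSeparatingElement F ζ) (D : Derivation F E M) (h : D ζ = 0)  :
    D = 0 := by
  have hadj : ∀ x ∈ IntermediateField.adjoin F {ζ}, D x = 0 := by
    intro x hx
    induction hx using IntermediateField.adjoin_induction with
    | mem x hx => rwa [Set.mem_singleton_iff.mp hx]
    | algebraMap a => simp
    | add x y _ _ hx hy => simp [hx, hy]
    | inv x _ hx => simp [Derivation.leibniz_inv, hx]
    | mul x y _ _ hx hy => simp [hx, hy]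
  -- Since `D` kills `F(ζ)`, it is `F(ζ)`-linear. Differentiating `m(x) = 0` for the minimal
  -- polynomial `m` of `x` gives `m'(x) • D x = 0`, and `m'(x) ≠ 0` by separability.
  let D' : Derivation (IntermediateField.adjoin F {ζ}) E M :=
    { toFun := D
      map_add' := map_add D
      map_smul' := fun c x => by
        change D ((c : E) * x) = (c : E) • D x
        simp [hadj c c.2]
      map_one_eq_zero' := D.map_one_eq_zero
      leibniz' := D.leibniz }
  have := hζ.isSeparable
  ext x
  have hx := D'.map_aeval (minpoly (IntermediateField.adjoin F {ζ}) x) x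
  rw [minpoly.aeval, map_zero] at hx
  exact (smul_eq_zero.mp hx.symm).resolve_left
    ((Algebra.IsSeparable.isSeparable (IntermediateField.adjoin F {ζ}) x).aeval_derivative_ne_zero
      (minpoly.aeval _ x))

theorem IsSeparatingElement.hasseDeriv_self {ζ : E} (hζ : IsSeparatingElement F ζ) :
    hζ.hasseDeriv ζ = 1 :=
  hζ.existsUnique_derivation.choose_spec.1

/-- Chain rule: the difference of the two sides vanishes at `ξ`. It makes the exceptional set of
places independent of `ζ`. -/
theorem IsSeparatingElement.hasseDeriv_eq_smul {ζ ξ : E} (hζ : IsSeparatingElement F ζ)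
    (hξ : IsSeparatingElement F ξ) : hζ.hasseDeriv = hζ.hasseDeriv ξ • hξ.hasseDeriv := by
  rw [← sub_eq_zero]
  apply hξ.derivation_eq_zero
  simp [hξ.hasseDeriv_self]

theorem IsSeparatingElement.hasseDeriv_ne_zero {ζ ξ : E} (hζ : IsSeparatingElement F ζ)
    (hξ : IsSeparatingElement F ξ) : hζ.hasseDeriv ξ ≠ 0 := by
  intro h
  have h1 := hζ.hasseDeriv_self
  rw [hζ.hasseDeriv_eq_smul hξ, h] at h1
  simp at h1

theorem Subalgebra.fg_restrictScalars_of_finite {A : Subalgebra F E} {C : Subalgebra A E}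
    (hA : Algebra.FiniteType F A) (hC : Module.Finite A C) : (C.restrictScalars F).FG := by
  have : IsScalarTower F A C := IsScalarTower.of_algebraMap_eq fun _ => rfl
  have h : Algebra.FiniteType F C := hA.trans inferInstance
  exact (Subalgebra.fg_iff_finiteType _).mpr h

open scoped IntermediateField.algebraAdjoinAdjoin in
/-- The integral closure of `F[ζ]` in a function field with separating element `ζ`: a Dedekind
domain, finitely generated over `F`. -/
theorem IsSeparatingElement.exists_dedekind_subalgebra [Algebra.EssFiniteType F E] {ζ : E}
    (hζ : IsSeparatingElement F ζ) : ∃ B : Subalgebra F E, IsDedekindDomain B ∧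
      IsFractionRing B E ∧ B.FG ∧ ∀ x ∈ B, IsIntegral (Algebra.adjoin F {ζ}) x := by
  let A := Algebra.adjoin F {ζ}
  let E₀ := IntermediateField.adjoin F {ζ}
  have : Algebra.IsSeparable E₀ E := hζ.isSeparable
  have : Algebra.EssFiniteType E₀ E := .of_comp F E₀ E
  have : Module.Finite E₀ E := Algebra.finite_of_essFiniteType_of_isAlgebraic
  have : IsPrincipalIdealRing A := by
    let g : Polynomial F →ₐ[F] A := Polynomial.aeval ⟨ζ, Algebra.self_mem_adjoin_singleton F ζ⟩
    refine IsPrincipalIdealRing.of_surjective g.toRingHom ?_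
    rintro ⟨x, hx⟩
    obtain ⟨q, hq⟩ : x ∈ (Polynomial.aeval ζ : Polynomial F →ₐ[F] E).range := by
      rwa [← Algebra.adjoin_singleton_eq_range_aeval]
    refine ⟨q, Subtype.ext (Eq.trans ?_ hq)⟩
    exact (Polynomial.aeval_algHom_apply A.val
      (⟨ζ, Algebra.self_mem_adjoin_singleton F ζ⟩ : A) q).symm
  refine ⟨(integralClosure A E).restrictScalars F, ?_, ?_, ?_, fun x hx => hx⟩
  · exact integralClosure.isDedekindDomain A E₀ E
  · exact integralClosure.isFractionRing_of_finite_extension E₀ E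
  -- Separability of `E` over `F(ζ)` is what makes the integral closure a finite module.
  · have h1 : Module.Finite A (integralClosure A E) :=
      IsIntegralClosure.finite A E₀ E (integralClosure A E)
    have h2 : Algebra.FiniteType F A :=
      (Subalgebra.fg_iff_finiteType _).mp ⟨{ζ}, by simp [A]⟩
    exact Subalgebra.fg_restrictScalars_of_finite h2 h1

end SeparatingElements

/-! ### Valuation rings of a function field in one variable -/

namespace ValuationSubring

/-! ### Valuation rings containing a Dedekind domain with the same fraction field -/

section Centre

variable {L : Type*} [Field L] {R : Type*} [CommRing R] [Algebra R L]

theorem mem_of_isIntegral {P : ValuationSubring L} (hR : ∀ a, algebraMap R L a ∈ P) {x : L}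
    (hx : IsIntegral R x) : x ∈ P := by
  let φ : R →+* P := (algebraMap R L).codRestrict P.toSubring hR
  have h : IsIntegral P x := hx.map_of_comp_eq φ (RingHom.id L) rfl
  obtain ⟨y, hy⟩ := IsIntegrallyClosed.isIntegral_iff.mp h
  exact hy ▸ y.2

theorem mem_of_mul_mem_of_valuation_eq_one {P : ValuationSubring L} {f s : L}
    (hs : P.valuation s = 1) (h : f * s ∈ P) : f ∈ P := by
  rwa [← valuation_le_one_iff, map_mul, hs, mul_one, valuation_le_one_iff] at h

variable [IsDedekindDomain R] [IsFractionRing R L]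

/-- A valuation ring containing a Dedekind domain with the same fraction field is a localization
of it. -/
theorem exists_mul_eq_algebraMap {P : ValuationSubring L} (hR : ∀ a, algebraMap R L a ∈ P)
    {f : L} (hf : f ∈ P) :
    ∃ x s : R, P.valuation (algebraMap R L s) = 1 ∧ f * algebraMap R L s = algebraMap R L x := by
  let φ : R →+* P := (algebraMap R L).codRestrict P.toSubring hR
  -- `Q` is the centre of `P` on `R`. If `Q = ⊥`, every nonzero denominator is a unit at `P`;
  -- otherwise `R_Q` is a discrete valuation ring, and `g`, `h` are comparable there for
  -- divisibility.
  let Q : Ideal R := (IsLocalRing.maximalIdeal P).comap φ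
  have : Q.IsPrime := Ideal.IsPrime.comap φ
  have hQ : ∀ {a : R}, a ∉ Q → P.valuation (algebraMap R L a) = 1 := fun {a} ha =>
    (P.valuation_lt_one_or_eq_one (φ a)).resolve_left fun h => ha ((P.valuation_lt_one_iff _).mpr h)
  have hQ' : ∀ {a : R}, a ∈ Q → P.valuation (algebraMap R L a) < 1 := fun {a} ha =>
    (P.valuation_lt_one_iff (φ a)).mp ha
  obtain ⟨g, h, hh, rfl⟩ := IsFractionRing.div_surjective (A := R) f
  have hh0 : h ≠ 0 := nonZeroDivisors.ne_zero hh
  have hh0' : algebraMap R L h ≠ 0 := by simpa using hh0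
  by_cases hQ0 : Q = ⊥
  · refine ⟨g, h, hQ (by simpa [hQ0] using hh0), by field_simp⟩
  have hdvr : IsDiscreteValuationRing (Localization.AtPrime Q) :=
    IsLocalization.AtPrime.isDiscreteValuationRing_of_dedekind_domain R hQ0 _
  have key : ∀ a b : R, ∀ c : Localization.AtPrime Q,
      algebraMap R (Localization.AtPrime Q) a * c = algebraMap R (Localization.AtPrime Q) b →
      ∃ x s : R, s ∉ Q ∧ a * x = b * s := by
    intro a b c hc
    obtain ⟨x, s, rfl⟩ := IsLocalization.exists_mk'_eq Q.primeCompl c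
    refine ⟨x, s, s.2, IsLocalization.injective (Localization.AtPrime Q)
      Q.primeCompl_le_nonZeroDivisors ?_⟩
    rw [map_mul, map_mul, ← hc, mul_assoc, IsLocalization.mk'_spec]
  obtain ⟨c, hc | hc⟩ := ValuationRing.cond (algebraMap R (Localization.AtPrime Q) g)
    (algebraMap R (Localization.AtPrime Q) h)
  · obtain ⟨x, s, hs, hxs⟩ := key _ _ _ hc
    have hxs' : algebraMap R L g / algebraMap R L h * algebraMap R L x = algebraMap R L s := by
      rw [div_mul_eq_mul_div, ← map_mul, hxs, map_mul]
      field_simp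
    -- Here `f * x = s` with `s ∉ Q`. If `x` were in `Q`, then `f ∈ P` would force `s` to have
    -- valuation less than one.
    refine ⟨s, x, hQ fun hx => ?_, hxs'⟩
    have h1 := hQ hs
    rw [← hxs', map_mul] at h1
    have h2 := (P.valuation_le_one_iff _).mpr hf
    exact absurd h1 (mul_comm _ (P.valuation _) ▸ mul_lt_one_of_lt_of_le (hQ' hx) h2).ne
  · obtain ⟨x, s, hs, hxs⟩ := key _ _ _ hc
    refine ⟨x, s, hQ hs, ?_⟩
    rw [div_mul_eq_mul_div, ← map_mul, ← hxs, map_mul]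
    field_simp

/-- Write an element of `P` as `x / s` with `s` a unit at `P`; by the hypothesis on centres `s` is
also a unit at `P'`. Used in both directions, this shows that the centre determines the valuation
ring. -/
theorem le_of_centre_le {P P' : ValuationSubring L} (hR : ∀ a, algebraMap R L a ∈ P)
    (hR' : ∀ a, algebraMap R L a ∈ P')
    (h : ∀ a : R, P'.valuation (algebraMap R L a) < 1 → P.valuation (algebraMap R L a) < 1) :
    P ≤ P' := by
  intro f hf
  obtain ⟨x, s, hs, hx⟩ := exists_mul_eq_algebraMap hR hf
  have hs' : P'.valuation (algebraMap R L s) = 1 :=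
    ((P'.valuation_le_one_iff _).mpr (hR' s)).eq_of_not_lt fun hlt => (h s hlt).ne hs
  exact mem_of_mul_mem_of_valuation_eq_one hs' (hx ▸ hR' x)

variable (R) in
-- The centre of such a `P` contains the numerator of `f`, hence is one of the finitely many primes
-- dividing it, and `P` is determined by its centre.
theorem finite_setOf_valuation_lt_one_of_dedekind {f : L} (hf : f ≠ 0) :
    {P : ValuationSubring L | (∀ a, algebraMap R L a ∈ P) ∧ P.valuation f < 1}.Finite := by
  obtain ⟨g, h, hh, rfl⟩ := IsFractionRing.div_surjective (A := R) f
  have hh0 : algebraMap R L h ≠ 0 := by simpa using nonZeroDivisors.ne_zero hh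
  have hg : g ≠ 0 := by
    rintro rfl
    simp at hf
  have hfin := Ideal.finite_factors (I := Ideal.span {g}) (by simpa using hg)
  refine Set.Finite.of_finite_image (f := fun P : ValuationSubring L =>
    {a : R | P.valuation (algebraMap R L a) < 1}) ?_ ?_
  · refine (hfin.image fun v => (v.asIdeal : Set R)).subset ?_
    rintro _ ⟨P, ⟨hP, hPf⟩, rfl⟩
    let φ : R →+* P := (algebraMap R L).codRestrict P.toSubring hP
    have hmem : ∀ a, a ∈ (IsLocalRing.maximalIdeal P).comap φ ↔
        P.valuation (algebraMap R L a) < 1 := fun a => P.valuation_lt_one_iff (φ a)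
    have hgm : g ∈ (IsLocalRing.maximalIdeal P).comap φ := by
      rw [hmem, show algebraMap R L g = algebraMap R L g / algebraMap R L h * algebraMap R L h by
        field_simp, map_mul]
      exact mul_lt_one_of_lt_of_le hPf ((P.valuation_le_one_iff _).mpr (hP h))
    refine ⟨⟨(IsLocalRing.maximalIdeal P).comap φ, Ideal.IsPrime.comap φ, ?_⟩, ?_, ?_⟩
    · exact fun h0 => hg (by simpa [h0] using hgm)
    · simpa [Ideal.dvd_span_singleton] using hgm
    · ext a
      exact hmem a
  · rintro P ⟨hP, -⟩ P' ⟨hP', -⟩ h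
    have h' : ∀ a : R, P.valuation (algebraMap R L a) < 1 ↔ P'.valuation (algebraMap R L a) < 1 :=
      fun a => Set.ext_iff.mp h a
    exact le_antisymm (le_of_centre_le hP hP' fun a => (h' a).mpr)
      (le_of_centre_le hP' hP fun a => (h' a).mp)

end Centre

/-! ### Places of a function field in one variable -/

section FunctionField

variable {K L : Type*} [Field K] [Field L] [Algebra K L]

theorem valuation_algebraMap_eq_one {P : ValuationSubring L} (hK : ∀ c, algebraMap K L c ∈ P)
    {c : K} (hc : c ≠ 0) : P.valuation (algebraMap K L c) = 1 := by
  refine le_antisymm ((P.valuation_le_one_iff _).mpr (hK c)) ?_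
  have h := (P.valuation_le_one_iff _).mpr (hK c⁻¹)
  rw [map_inv₀, map_inv₀] at h
  exact (inv_le_one₀ (zero_lt_iff.mpr (by simpa using hc))).mp h

/-- The residue field at a place of a function field in one variable over an algebraically closed
field is the field of constants. -/
theorem exists_valuation_sub_lt_one [IsAlgClosed K] (htr : Algebra.trdeg K L = 1)
    {P : ValuationSubring L} (hK : ∀ c, algebraMap K L c ∈ P) (hP : P ≠ ⊤) {f : L} (hf : f ∈ P) :
    ∃ c, P.valuation (f - algebraMap K L c) < 1 := by
  -- Otherwise every `f - c` is a unit at `P`, hence so is `q(f)` for every nonzero polynomial `q`.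
  -- Then `f` is transcendental and `K(f) ⊆ P`; as `L` is algebraic over `K(f)` and `P` is
  -- integrally closed, `P = ⊤`.
  by_contra! h
  have h1 : ∀ c, P.valuation (f - algebraMap K L c) = 1 := fun c =>
    le_antisymm ((P.valuation_le_one_iff _).mpr (sub_mem hf (hK c))) (h c)
  have hval : ∀ q : Polynomial K, q ≠ 0 → P.valuation (Polynomial.aeval f q) = 1 := by
    intro q hq
    rw [(IsAlgClosed.splits q).eq_prod_roots, map_mul, map_multiset_prod, Multiset.map_map,
      map_mul, map_multiset_prod, Multiset.map_map, Polynomial.aeval_C,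
      valuation_algebraMap_eq_one hK (by simpa using hq), one_mul]
    refine Multiset.prod_eq_one fun x hx => ?_
    obtain ⟨c, -, rfl⟩ := Multiset.mem_map.mp hx
    simpa using h1 c
  have htrans : Transcendental K f := fun ⟨q, hq, hq0⟩ => by simpa [hq0] using hval q hq
  have := isAlgebraic_adjoin_of_transcendental htr htrans
  have hadj : ∀ a, algebraMap (IntermediateField.adjoin K {f}) L a ∈ P := by
    rintro ⟨a, ha⟩
    obtain ⟨r, s, rfl⟩ := (IntermediateField.mem_adjoin_simple_iff K a).mp ha
    rw [← valuation_le_one_iff]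
    change P.valuation (Polynomial.aeval f r / Polynomial.aeval f s) ≤ 1
    rw [map_div₀]
    by_cases hr : r = 0
    · simp [hr]
    by_cases hs : s = 0
    · simp [hs]
    rw [hval r hr, hval s hs, div_one]
  refine hP (SetLike.ext fun x => iff_of_true (mem_of_isIntegral hadj ?_) (mem_top x))
  exact (Algebra.IsAlgebraic.isAlgebraic x).isIntegral

variable [PerfectField K] [Algebra.EssFiniteType K L]

/-- A nonzero function has finitely many zeros. -/
theorem finite_setOf_valuation_lt_one (htr : Algebra.trdeg K L = 1) {f : L} (hf : f ≠ 0) :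
    {P : ValuationSubring L | (∀ c, algebraMap K L c ∈ P) ∧ P.valuation f < 1}.Finite := by
  have aux : ∀ {ζ : L}, IsSeparatingElement K ζ → ∀ {g : L}, g ≠ 0 →
      {P : ValuationSubring L | (∀ c, algebraMap K L c ∈ P) ∧ ζ ∈ P ∧ P.valuation g < 1}.Finite := by
    intro ζ hζ g hg
    obtain ⟨B, hded, hfrac, -, hint⟩ := hζ.exists_dedekind_subalgebra
    refine (finite_setOf_valuation_lt_one_of_dedekind B hg).subset ?_
    rintro P ⟨hK, hζP, hgP⟩
    refine ⟨fun a => mem_of_isIntegral (R := Algebra.adjoin K {ζ}) ?_ (hint a a.2), hgP⟩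
    rintro ⟨a, ha⟩
    change a ∈ P
    induction ha using Algebra.adjoin_induction with
    | mem x hx => rwa [Set.mem_singleton_iff.mp hx]
    | algebraMap c => exact hK c
    | add x y _ _ hx hy => exact AddMemClass.add_mem hx hy
    | mul x y _ _ hx hy => exact MulMemClass.mul_mem hx hy
  obtain ⟨ζ, hζ⟩ := exists_isSeparatingElement (F := K) (E := L) htr
  have hζ0 : ζ ≠ 0 := fun h => hζ.transcendental (h ▸ isAlgebraic_zero)
  -- Places with `ζ ∈ P` are covered by `aux` for `f`. The remaining ones are zeros of `ζ⁻¹`, so the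
  -- second set is that of `aux` for the function `ζ⁻¹` and does not involve `f`.
  refine ((aux hζ hf).union (aux hζ.inv (inv_ne_zero hζ0))).subset ?_
  rintro P ⟨hK, hPf⟩
  by_cases hζP : ζ ∈ P
  · exact Or.inl ⟨hK, hζP, hPf⟩
  · have : ζ⁻¹ ∈ P.nonunits := P.inv_mem_nonunits_iff.mpr (Or.inr hζP)
    exact Or.inr ⟨hK, P.nonunits_subset this, this⟩

/-- A function has finitely many poles. -/
theorem finite_setOf_notMem (htr : Algebra.trdeg K L = 1) (f : L) :
    {P : ValuationSubring L | (∀ c, algebraMap K L c ∈ P) ∧ f ∉ P}.Finite := by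
  by_cases hf : f = 0
  · simp [hf]
  refine (finite_setOf_valuation_lt_one htr (inv_ne_zero hf)).subset ?_
  rintro P ⟨hK, hfP⟩
  exact ⟨hK, P.inv_mem_nonunits_iff.mpr (Or.inr hfP)⟩

/-- A derivation of a function field preserves all but finitely many of its valuation rings. -/
theorem finite_setOf_not_derivation_mem (htr : Algebra.trdeg K L = 1) (D : Derivation K L L) :
    {P : ValuationSubring L | (∀ c, algebraMap K L c ∈ P) ∧ ¬ ∀ x ∈ P, D x ∈ P}.Finite := by
  obtain ⟨ζ, hζ⟩ := exists_isSeparatingElement (F := K) (E := L) htr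
  obtain ⟨B, hded, hfrac, ⟨S, hS⟩, -⟩ := hζ.exists_dedekind_subalgebra
  -- Only the poles of the generators of `B` and of their derivatives are excluded. The Leibniz rule
  -- then gives `B ⊆ P` and `D B ⊆ P`, and the quotient rule extends this to `P`, whose elements are
  -- fractions from `B` with denominators that are units at `P`.
  refine ((S.finite_toSet.biUnion fun f _ => finite_setOf_notMem htr f).union
    (S.finite_toSet.biUnion fun f _ => finite_setOf_notMem htr (D f))).subset ?_
  rintro P ⟨hK, hP⟩
  by_contra hmem
  simp only [Set.mem_union, Set.mem_iUnion, Set.mem_ofPred_eq, not_or, not_exists, not_and,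
    not_not] at hmem
  have hB : ∀ x ∈ B, x ∈ P ∧ D x ∈ P := by
    intro x hx
    rw [← hS] at hx
    induction hx using Algebra.adjoin_induction with
    | mem x hx => exact ⟨hmem.1 x hx hK, hmem.2 x hx hK⟩
    | algebraMap c => exact ⟨hK c, by simp⟩
    | add x y _ _ hx hy => exact ⟨AddMemClass.add_mem hx.1 hy.1, by simpa using AddMemClass.add_mem hx.2 hy.2⟩
    | mul x y _ _ hx hy =>
      refine ⟨MulMemClass.mul_mem hx.1 hy.1, ?_⟩
      rw [D.leibniz]
      exact AddMemClass.add_mem (MulMemClass.mul_mem hx.1 hy.2) (MulMemClass.mul_mem hy.1 hx.2)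
  refine hP fun f hf => ?_
  obtain ⟨x, s, hs, hx⟩ := exists_mul_eq_algebraMap (R := B) (fun a => (hB a a.2).1) hf
  replace hx : f * s = x := hx
  replace hs : P.valuation (s : L) = 1 := hs
  have hD : D f * s = D x - f * D s := by
    rw [← hx, D.leibniz]
    simp only [smul_eq_mul]
    ring
  refine mem_of_mul_mem_of_valuation_eq_one hs (hD ▸ ?_)
  exact sub_mem (hB x x.2).2 (MulMemClass.mul_mem hf (hB s s.2).2)

end FunctionField

/-- The restriction of a derivation of a field to a valuation ring that it preserves. -/
def restrictDerivation {K L : Type*} [CommRing K] [Field L] [Algebra K L] (P : ValuationSubring L)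
    (D : Derivation K L L) (hD : ∀ x ∈ P, D x ∈ P) : Derivation ℤ P P :=
  Derivation.mk' (AddMonoidHom.toIntLinearMap
    { toFun := fun x => ⟨D (x : L), hD x x.2⟩
      map_zero' := Subtype.ext (map_zero D)
      map_add' := fun x y => Subtype.ext (map_add D (x : L) (y : L)) })
    fun x y => Subtype.ext (D.leibniz (x : L) (y : L))

@[simp]
theorem coe_restrictDerivation {K L : Type*} [CommRing K] [Field L] [Algebra K L]
    (P : ValuationSubring L) (D : Derivation K L L) (hD : ∀ x ∈ P, D x ∈ P) (x : P) :
    (P.restrictDerivation D hD x : L) = D (x : L) :=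
  rfl

end ValuationSubring

/-! ### Frobenius-twisted relations over a discrete valuation ring -/

theorem sum_pow_mul_eq_of_relation {R : Type*} [CommRing R] (p : ℕ) [Fact p.Prime] [CharP R p]
    {ι : Type*} [Fintype ι] (r : ℕ) {ϖ : R} {u b c x : ι → R}
    (hc : ∀ i, u i - b i = ϖ * c i) (hrel : ∑ i, u i ^ p ^ r * x i = 0) :
    ∑ i, b i ^ p ^ r * x i = ϖ ^ p ^ r * -∑ i, c i ^ p ^ r * x i := by
  have h : ∀ i, b i ^ p ^ r * x i =
      u i ^ p ^ r * x i - ϖ ^ p ^ r * (c i ^ p ^ r * x i) := fun i => by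
    rw [← mul_assoc, ← mul_pow, ← hc, sub_pow_char_pow]
    ring
  rw [Finset.sum_congr rfl fun i _ => h i, Finset.sum_sub_distrib, hrel, ← Finset.mul_sum]
  ring

namespace IsDiscreteValuationRing

variable {R : Type*} [CommRing R] [IsDomain R] [IsDiscreteValuationRing R]

/-- A nonunit at which a derivation takes the value `1` is a uniformizer. -/
theorem irreducible_of_derivation_eq_one (δ : Derivation ℤ R R) {t : R}
    (ht : t ∈ IsLocalRing.maximalIdeal R) (h : δ t = 1) : Irreducible t := by
  obtain ⟨ϖ, hϖ⟩ := IsDiscreteValuationRing.exists_irreducible R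
  rw [hϖ.maximalIdeal_eq, Ideal.mem_span_singleton] at ht
  obtain ⟨c, rfl⟩ := ht
  suffices hc : IsUnit c from (irreducible_mul_isUnit hc).mpr hϖ
  -- If `c` were a nonunit, both Leibniz terms of `δ (ϖ * c) = 1` would lie in the maximal ideal.
  by_contra hc
  have h2 : ϖ • δ c + c • δ ϖ ∈ IsLocalRing.maximalIdeal R :=
    add_mem (Ideal.mul_mem_right _ _ hϖ.1) (Ideal.mul_mem_right _ _ hc)
  rw [← δ.leibniz, h] at h2
  exact h2 isUnit_one

variable (p : ℕ) [Fact p.Prime] [CharP R p] {ι : Type*} [Fintype ι] (r : ℕ)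

theorem le_addVal_sum_pow_mul {u b x : ι → R}
    (hub : ∀ i, u i - b i ∈ IsLocalRing.maximalIdeal R)
    (hrel : ∑ i, u i ^ p ^ r * x i = 0) :
    ((p ^ r : ℕ) : ℕ∞) ≤ addVal R (∑ i, b i ^ p ^ r * x i) := by
  obtain ⟨ϖ, hϖ⟩ := IsDiscreteValuationRing.exists_irreducible R
  have hdvd : ∀ i, ∃ c, u i - b i = ϖ * c := fun i => by
    have := hub i
    rwa [hϖ.maximalIdeal_eq, Ideal.mem_span_singleton] at this
  choose c hc using hdvd
  rw [sum_pow_mul_eq_of_relation p r hc hrel, ← hϖ.addVal_pow, addVal_le_iff_dvd]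
  exact dvd_mul_right _ _

/-- Modulo `t`, `δ (u i)` is the first Taylor coefficient `c i` of `u i`. Constants enter only
through `δ (b i) = 0`, so a derivation over `ℤ` suffices. -/
theorem addVal_sum_pow_mul_eq_iff (δ : Derivation ℤ R R) {t : R}
    (ht : t ∈ IsLocalRing.maximalIdeal R) (hδt : δ t = 1) {u b x : ι → R}
    (hub : ∀ i, u i - b i ∈ IsLocalRing.maximalIdeal R) (hδb : ∀ i, δ (b i) = 0)
    (hrel : ∑ i, u i ^ p ^ r * x i = 0) :
    addVal R (∑ i, b i ^ p ^ r * x i) = ((p ^ r : ℕ) : ℕ∞) ↔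
      IsUnit (∑ i, δ (u i) ^ p ^ r * x i) := by
  have hirr := irreducible_of_derivation_eq_one δ ht hδt
  have hdvd : ∀ i, ∃ c, u i - b i = t * c := fun i => by
    have := hub i
    rwa [hirr.maximalIdeal_eq, Ideal.mem_span_singleton] at this
  choose c hc using hdvd
  have hq : p ^ r ≠ 0 := pow_ne_zero _ (Fact.out : p.Prime).ne_zero
  have hδu : ∀ i, δ (u i) = c i + t * δ (c i) := fun i => by
    have h := congrArg δ (hc i)
    rw [map_sub, hδb, sub_zero, δ.leibniz, hδt] at h
    rw [h]
    simp only [smul_eq_mul]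
    ring
  have hsum : ∑ i, δ (u i) ^ p ^ r * x i =
      t ^ p ^ r * ∑ i, δ (c i) ^ p ^ r * x i + ∑ i, c i ^ p ^ r * x i := by
    rw [Finset.mul_sum, ← Finset.sum_add_distrib]
    refine Finset.sum_congr rfl fun i _ => ?_
    rw [hδu, add_pow_char_pow]
    ring
  have hmem : t ^ p ^ r * ∑ i, δ (c i) ^ p ^ r * x i ∈ IsLocalRing.maximalIdeal R :=
    Ideal.mul_mem_right _ _ (Ideal.pow_mem_of_mem _ ht _ (Nat.pos_of_ne_zero hq))
  have hcancel : ∀ m : ℕ∞, ((p ^ r : ℕ) : ℕ∞) + m = ((p ^ r : ℕ) : ℕ∞) ↔ m = 0 := fun m => by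
    simpa only [add_zero] using
      (ENat.add_right_injective_of_ne_top (ENat.natCast_ne_top (p ^ r))).eq_iff (a := m) (b := 0)
  rw [sum_pow_mul_eq_of_relation p r hc hrel, addVal_mul, hirr.addVal_pow,
    hcancel, addVal_eq_zero_iff, IsUnit.neg_iff, hsum, ← not_iff_not]
  exact ((IsLocalRing.maximalIdeal R).add_mem_iff_right hmem).symm

end IsDiscreteValuationRing

/-! ### Extension of constants -/

section ConstantExtension

variable {k K E L : Type*} [Field k] [Field K] [Field E] [Field L] [Algebra k K] [Algebra k E]
  [Algebra k L] [Algebra K L] [IsScalarTower k K L]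

/-- Algebraicity of `K` over `k` preserves transcendence. The elements separable over `K(σ ζ)` form
a field containing `K` and the image of `σ`, which together generate `L`. -/
theorem IsSeparatingElement.map [Algebra.IsAlgebraic k K] {ζ : E} (hζ : IsSeparatingElement k ζ)
    (σ : E →ₐ[k] L) (hσ : IntermediateField.adjoin K (Set.range σ) = ⊤) :
    IsSeparatingElement K (σ ζ) where
  transcendental h := hζ.transcendental
    ((isAlgebraic_algHom_iff σ σ.injective).mp (h.restrictScalars k))
  isSeparable := by
    let E₀ := IntermediateField.adjoin k {ζ}
    let L₀ := IntermediateField.adjoin K {σ ζ}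
    have := hζ.isSeparable
    have hmem : ∀ a : E₀, σ a ∈ L₀ := by
      have hle : E₀ ≤ (L₀.restrictScalars k).comap σ :=
        IntermediateField.adjoin_simple_le_iff.mpr (IntermediateField.mem_adjoin_simple_self K (σ ζ))
      exact fun a => hle a.2
    let φ : E₀ →+* L₀ := ((σ : E →+* L).comp (algebraMap E₀ E)).codRestrict L₀.toSubring hmem
    have hsep : ∀ z : E, IsSeparable L₀ (σ z) := by
      intro z
      have hz : (minpoly E₀ z).Separable := Algebra.IsSeparable.isSeparable E₀ z
      refine (hz.map (f := φ)).of_dvd (minpoly.dvd _ _ ?_)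
      rw [Polynomial.aeval_def, Polynomial.eval₂_map]
      have h := congrArg σ (minpoly.aeval E₀ z)
      rw [Polynomial.aeval_def, map_zero] at h
      rw [← h]
      exact (Polynomial.hom_eval₂ _ _ (σ : E →+* L) z).symm
    have htop : (separableClosure L₀ L).restrictScalars K = ⊤ := by
      rw [eq_top_iff, ← hσ, IntermediateField.adjoin_le_iff]
      rintro _ ⟨z, rfl⟩
      exact mem_separableClosure_iff.mpr (hsep z)
    refine ⟨fun x => mem_separableClosure_iff.mp ?_⟩
    change x ∈ (separableClosure L₀ L).restrictScalars K
    rw [htop]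
    trivial

/-- Both sides are `k`-derivations from `E` to `L`, viewed as an `E`-module through `σ`, that agree
at `ζ`. -/
theorem IsSeparatingElement.hasseDeriv_map {ζ : E} (hζ : IsSeparatingElement k ζ) (σ : E →ₐ[k] L)
    (hσζ : IsSeparatingElement K (σ ζ)) (z : E) :
    hσζ.hasseDeriv (σ z) = σ (hζ.hasseDeriv z) := by
  let _ : Algebra E L := σ.toRingHom.toAlgebra
  have _ : IsScalarTower k E L := IsScalarTower.of_algebraMap_eq fun a => (σ.commutes a).symm
  let D : Derivation k E L := (hσζ.hasseDeriv.restrictScalars k).compAlgebraMap E -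
    (Algebra.linearMap E L).compDer hζ.hasseDeriv
  have hD : ∀ x, D x = hσζ.hasseDeriv (σ x) - σ (hζ.hasseDeriv x) := fun x => rfl
  have h0 : D = 0 := hζ.derivation_eq_zero D (by
    rw [hD, hσζ.hasseDeriv_self, hζ.hasseDeriv_self, map_one, sub_self])
  rw [← sub_eq_zero, ← hD, h0]
  rfl

end ConstantExtension

/-! ### Places of a function field -/

section Places

open IsDiscreteValuationRing

namespace ValuationSubring

theorem charP_of_charP {L : Type*} [Field L] (P : ValuationSubring L) (p : ℕ) [CharP L p] :
    CharP P p :=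
  (algebraMap P L).charP Subtype.val_injective p

variable {K L : Type*} [Field K] [Field L] [Algebra K L] (P : ValuationSubring L)
  [IsDiscreteValuationRing P] (p : ℕ) [Fact p.Prime] [CharP L p] (r : ℕ) {ι : Type*} [Fintype ι]

theorem ne_top_of_isDiscreteValuationRing : P ≠ ⊤ := by
  intro h
  refine IsDiscreteValuationRing.not_isField P ?_
  refine { exists_pair_ne := ⟨0, 1, zero_ne_one⟩, mul_comm := mul_comm, mul_inv_cancel := ?_ }
  intro a ha
  have hmem : (a : L)⁻¹ ∈ P := SetLike.ext_iff.mp h _ |>.mpr (mem_top _)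
  exact ⟨⟨_, hmem⟩, Subtype.ext (mul_inv_cancel₀ fun h0 => ha (Subtype.ext h0))⟩

variable {P} (hK : ∀ c, algebraMap K L c ∈ P) {u : ι → L} {b : ι → K} {x : ι → P}

theorem le_addVal_sum_pow_mul (hub : ∀ i, P.valuation (u i - algebraMap K L (b i)) < 1)
    (hrel : ∑ i, u i ^ p ^ r * x i = 0) :
    ((p ^ r : ℕ) : ℕ∞) ≤ addVal P (∑ i, (⟨_, hK (b i)⟩ : P) ^ p ^ r * x i) := by
  have := P.charP_of_charP p
  have hu : ∀ i, u i ∈ P := fun i => by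
    simpa using AddMemClass.add_mem (P.mem_of_valuation_le_one _ (hub i).le) (hK (b i))
  have h1 : ∀ i, (⟨u i, hu i⟩ : P) - ⟨_, hK (b i)⟩ ∈ IsLocalRing.maximalIdeal P :=
    fun i => (P.valuation_lt_one_iff _).mpr (hub i)
  have h2 : ∑ i, (⟨u i, hu i⟩ : P) ^ p ^ r * x i = 0 := Subtype.ext (by simpa using hrel)
  exact IsDiscreteValuationRing.le_addVal_sum_pow_mul p r h1 h2

/-- The uniformizer is `ζ - c`, with `c` the value of `ζ` at `P`; its derivative is `1`. -/
theorem addVal_sum_pow_mul_eq_iff (hub : ∀ i, P.valuation (u i - algebraMap K L (b i)) < 1)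
    (hrel : ∑ i, u i ^ p ^ r * x i = 0) {D : Derivation K L L} (hD : ∀ z ∈ P, D z ∈ P) {ζ : L}
    (hDζ : D ζ = 1) {c : K} (hc : P.valuation (ζ - algebraMap K L c) < 1) :
    addVal P (∑ i, (⟨_, hK (b i)⟩ : P) ^ p ^ r * x i) = ((p ^ r : ℕ) : ℕ∞) ↔
      P.valuation (∑ i, D (u i) ^ p ^ r * x i) = 1 := by
  have := P.charP_of_charP p
  have hu : ∀ i, u i ∈ P := fun i => by
    simpa using AddMemClass.add_mem (P.mem_of_valuation_le_one _ (hub i).le) (hK (b i))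
  have h1 : ∀ i, (⟨u i, hu i⟩ : P) - ⟨_, hK (b i)⟩ ∈ IsLocalRing.maximalIdeal P :=
    fun i => (P.valuation_lt_one_iff _).mpr (hub i)
  have h2 : ∑ i, (⟨u i, hu i⟩ : P) ^ p ^ r * x i = 0 := Subtype.ext (by simpa using hrel)
  have h3 : (⟨_, P.mem_of_valuation_le_one _ hc.le⟩ : P) ∈ IsLocalRing.maximalIdeal P :=
    (P.valuation_lt_one_iff _).mpr hc
  rw [IsDiscreteValuationRing.addVal_sum_pow_mul_eq_iff p r (P.restrictDerivation D hD) h3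
    (Subtype.ext (by simp [hDζ])) h1 (fun i => Subtype.ext (by simp)) h2, valuation_eq_one_iff]
  simp

end ValuationSubring

variable {K L : Type*} [Field K] [Field L] [Algebra K L] [PerfectField K]
  [Algebra.EssFiniteType K L] {Pl : Type*} {O : Pl → ValuationSubring L}

theorem eventually_mem_valuationSubring (htr : Algebra.trdeg K L = 1)
    (hO : Function.Injective O) (hK : ∀ P c, algebraMap K L c ∈ O P) (f : L) :
    ∀ᶠ P in Filter.cofinite, f ∈ O P := by
  rw [Filter.eventually_cofinite]
  exact ((ValuationSubring.finite_setOf_notMem htr f).preimage hO.injOn).subset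
    fun P hP => ⟨hK P, hP⟩

theorem eventually_valuation_eq_one (htr : Algebra.trdeg K L = 1)
    (hO : Function.Injective O) (hK : ∀ P c, algebraMap K L c ∈ O P) {f : L} (hf : f ≠ 0) :
    ∀ᶠ P in Filter.cofinite, (O P).valuation f = 1 := by
  have h : ∀ᶠ P in Filter.cofinite, ¬ (O P).valuation f < 1 := by
    rw [Filter.eventually_cofinite]
    exact ((ValuationSubring.finite_setOf_valuation_lt_one htr hf).preimage hO.injOn).subset
      fun P hP => ⟨hK P, not_not.mp hP⟩
  filter_upwards [h, eventually_mem_valuationSubring htr hO hK f] with P h1 h2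
  exact (((O P).valuation_le_one_iff f).mpr h2).eq_of_not_lt h1

theorem eventually_derivation_mem (htr : Algebra.trdeg K L = 1)
    (hO : Function.Injective O) (hK : ∀ P c, algebraMap K L c ∈ O P) (D : Derivation K L L) :
    ∀ᶠ P in Filter.cofinite, ∀ x ∈ O P, D x ∈ O P := by
  rw [Filter.eventually_cofinite]
  exact ((ValuationSubring.finite_setOf_not_derivation_mem htr D).preimage hO.injOn).subset
    fun P hP => ⟨hK P, hP⟩

/-- The order of contact of a curve with the hyperplanes given by a Frobenius-twisted relation
between its coordinate functions `y i`, at all but finitely many places. The functions `x i` are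
the affine coordinates in a chart around the place. -/
theorem eventually_addVal_sum_pow_mul {k E ι : Type*} [Fintype ι] [Field k] [Field E]
    [Algebra k K] [Algebra k E] [Algebra k L] [IsScalarTower k K L] [Algebra.IsAlgebraic k K]
    [IsAlgClosed K] (htr : Algebra.trdeg K L = 1) (hO : Function.Injective O)
    (hK : ∀ P c, algebraMap K L c ∈ O P) [∀ P, IsDiscreteValuationRing (O P)] (σ : E →ₐ[k] L)
    (hσ : IntermediateField.adjoin K (Set.range σ) = ⊤) (p : ℕ) [Fact p.Prime] [CharP k p]
    (r : ℕ) {u y : ι → E} (hy : y ≠ 0) (hu : u ≠ 0) (hrel : ∑ i, u i ^ p ^ r * y i = 0) :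
    ∀ᶠ P in Filter.cofinite, ∃ b : ι → K, b ≠ 0 ∧
      (∀ i, (O P).valuation (σ (u i) - algebraMap K L (b i)) < 1) ∧
      ∀ (x : ι → O P) (j : ι), (∀ i, σ (y i) = σ (y j) * x i) →
        ((p ^ r : ℕ) : ℕ∞) ≤ addVal (O P) (∑ i, (⟨_, hK P (b i)⟩ : O P) ^ p ^ r * x i) ∧
        ∀ (ζ : E) (hζ : IsSeparatingElement k ζ),
          (addVal (O P) (∑ i, (⟨_, hK P (b i)⟩ : O P) ^ p ^ r * x i) = ((p ^ r : ℕ) : ℕ∞) ↔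
            ∑ i, hζ.hasseDeriv (u i) ^ p ^ r * y i ≠ 0) := by
  have : CharP L p := charP_of_injective_algebraMap' k p
  obtain ⟨i₀, hi₀⟩ := Function.ne_iff.mp hu
  have hyj : ∀ {P} {x : ι → O P} {j : ι}, (∀ i, σ (y i) = σ (y j) * x i) → σ (y j) ≠ 0 := by
    intro P x j hx h0
    refine hy (funext fun i => (map_eq_zero σ).mp ?_)
    rw [hx, h0, zero_mul]
  have hsum : ∀ {P} {x : ι → O P} {j : ι}, (∀ i, σ (y i) = σ (y j) * x i) → ∀ w : ι → E,
      σ (∑ i, w i ^ p ^ r * y i) = σ (y j) * ∑ i, σ (w i) ^ p ^ r * x i := by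
    intro P x j hx w
    rw [map_sum, Finset.mul_sum]
    refine Finset.sum_congr rfl fun i _ => ?_
    rw [map_mul, map_pow, hx]
    ring
  have hrel' : ∀ {P} {x : ι → O P} {j : ι}, (∀ i, σ (y i) = σ (y j) * x i) →
      ∑ i, σ (u i) ^ p ^ r * x i = 0 := by
    intro P x j hx
    have h := hsum hx u
    rw [hrel, map_zero] at h
    exact (mul_eq_zero.mp h.symm).resolve_left (hyj hx)
  have hbase : ∀ᶠ P in Filter.cofinite, ∃ b : ι → K, b ≠ 0 ∧
      ∀ i, (O P).valuation (σ (u i) - algebraMap K L (b i)) < 1 := by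
    filter_upwards [Filter.eventually_all.mpr fun i =>
      eventually_mem_valuationSubring htr hO hK (σ (u i)),
      eventually_valuation_eq_one htr hO hK ((map_ne_zero σ).mpr hi₀)] with P hP hP₀
    choose b hb using fun i => ValuationSubring.exists_valuation_sub_lt_one htr (hK P)
      (O P).ne_top_of_isDiscreteValuationRing (hP i)
    refine ⟨b, ?_, hb⟩
    rintro rfl
    have h := hb i₀
    rw [Pi.zero_apply, map_zero, sub_zero, hP₀] at h
    exact lt_irrefl _ h
  -- The element `ξ` must be fixed before places are discarded. If none exists, the claim about `ζ`
  -- is vacuous.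
  by_cases hex : ∃ ξ : E, IsSeparatingElement k ξ
  swap
  · filter_upwards [hbase] with P ⟨b, hb0, hb⟩
    exact ⟨b, hb0, hb, fun x j hx => ⟨ValuationSubring.le_addVal_sum_pow_mul p r (hK P) hb
      (hrel' hx), fun ζ hζ => (hex ⟨ζ, hζ⟩).elim⟩⟩
  obtain ⟨ξ, hξ⟩ := hex
  have hσξ : IsSeparatingElement K (σ ξ) := hξ.map σ hσ
  let w : E := ∑ i, hξ.hasseDeriv (u i) ^ p ^ r * y i
  have hunit : ∀ z : E, ∀ᶠ P in Filter.cofinite, z ≠ 0 → (O P).valuation (σ z) = 1 := by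
    intro z
    by_cases hz : z = 0
    · simp [hz]
    · filter_upwards [eventually_valuation_eq_one htr hO hK ((map_ne_zero σ).mpr hz)] with P hP _
        using hP
  filter_upwards [hbase, hunit w, Filter.eventually_all.mpr fun i => hunit (y i),
    eventually_derivation_mem htr hO hK hσξ.hasseDeriv,
    eventually_mem_valuationSubring htr hO hK (σ ξ)] with P ⟨b, hb0, hb⟩ hPw hPy hPD hPξ
  obtain ⟨c, hc⟩ := ValuationSubring.exists_valuation_sub_lt_one htr (hK P)
    (O P).ne_top_of_isDiscreteValuationRing hPξ
  refine ⟨b, hb0, hb, fun x j hx => ⟨ValuationSubring.le_addVal_sum_pow_mul p r (hK P) hb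
    (hrel' hx), fun ζ hζ => ?_⟩⟩
  have hζξ : ∑ i, hζ.hasseDeriv (u i) ^ p ^ r * y i = hζ.hasseDeriv ξ ^ p ^ r * w := by
    rw [Finset.mul_sum]
    refine Finset.sum_congr rfl fun i _ => ?_
    rw [hζ.hasseDeriv_eq_smul hξ, Derivation.smul_apply, Derivation.smul_apply,
      hξ.hasseDeriv_self, smul_eq_mul, smul_eq_mul, mul_one, mul_pow, mul_assoc]
  -- The two functions differ by the factor `σ (y j)`, a unit at `P` because the zeros and poles of
  -- the nonzero `y i` have been discarded.
  have hw : (O P).valuation (σ w) =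
      (O P).valuation (∑ i, hσξ.hasseDeriv (σ (u i)) ^ p ^ r * x i) := by
    simp only [hξ.hasseDeriv_map σ hσξ]
    rw [hsum hx, map_mul, hPy j ((map_ne_zero σ).mp (hyj hx)), one_mul]
  rw [ValuationSubring.addVal_sum_pow_mul_eq_iff p r (hK P) hb (hrel' hx) hPD
    hσξ.hasseDeriv_self hc, hζξ, mul_ne_zero_iff,
    and_iff_right (pow_ne_zero _ (hζ.hasseDeriv_ne_zero hξ)), ← hw]
  refine ⟨fun h h0 => ?_, hPw⟩
  rw [h0, map_zero, map_zero] at h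
  exact zero_ne_one h

end Places

/-! ### The function field of a projective curve -/

namespace ProjVariety

variable {K : Type*} [Field K] {n : ℕ} (Y : ProjVariety K n)

theorem essFiniteType_functionField : Algebra.EssFiniteType K (Y.functionField K) := by
  rw [IntermediateField.essFiniteType_iff]
  refine IntermediateField.fg_adjoin_of_finite ?_
  refine (Set.finite_range fun ij : Fin (n + 1) × Fin (n + 1) =>
    Y.coord ij.1 / Y.coord ij.2).subset ?_
  rintro _ ⟨i, j, rfl⟩
  exact ⟨(i, j), rfl⟩

/-- The ratios generating `K(Y)` over `K` already lie in `F(Y)`. -/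
theorem adjoin_range_incl (F : Type*) [Field F] [Algebra F K] :
    IntermediateField.adjoin K (Set.range (Y.incl F)) = ⊤ := by
  rw [eq_top_iff]
  rintro ⟨x, hx⟩ -
  induction hx using IntermediateField.adjoin_induction with
  | mem x hx =>
    obtain ⟨i, j, rfl⟩ := hx
    refine IntermediateField.subset_adjoin _ _ ⟨⟨Y.coord i / Y.coord j, ?_⟩, rfl⟩
    exact IntermediateField.subset_adjoin _ _ ⟨i, j, rfl⟩
  | algebraMap c => exact IntermediateField.algebraMap_mem _ c
  | add x y hx hy h1 h2 => exact add_mem h1 h2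
  | inv x hx h => exact inv_mem h
  | mul x y hx hy h1 h2 => exact mul_mem h1 h2

variable {Y}

theorem IsCoordinateFunctions.incl_eq_mul_ratio {F : Type*} [Field F] [Algebra F K]
    {y : Fin (n + 1) → Y.functionField F} (hy : Y.IsCoordinateFunctions y) {j : Fin (n + 1)}
    (hj : Y.coord j ≠ 0) (i : Fin (n + 1)) :
    Y.incl F (y i) = Y.incl F (y j) * Y.ratio i j :=
  Subtype.ext (by
    change (y i : Y.ConeField) = (y j : Y.ConeField) * (Y.coord i / Y.coord j)
    rw [← mul_div_assoc, ← hy.2 i j, mul_div_cancel_right₀ _ hj])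

namespace ModelPoint

theorem ring_injective : Function.Injective (ModelPoint.ring : Y.ModelPoint → _) := by
  rintro ⟨P, _, _⟩ ⟨P', _, _⟩ h
  cases h
  rfl

variable (P : Y.ModelPoint)

theorem coord_chart_ne_zero : Y.coord P.chart ≠ 0 :=
  P.exists_chart.choose_spec.1

theorem ratio_chart_mem (i : Fin (n + 1)) : Y.ratio i P.chart ∈ P.ring :=
  P.exists_chart.choose_spec.2 i

theorem intersectionMultiplicity_pow (b : Fin (n + 1) → K) (q : ℕ) :
    P.intersectionMultiplicity (fun i => b i ^ q) =
      IsDiscreteValuationRing.addVal P.ring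
        (∑ i, (⟨_, P.algebraMap_mem (b i)⟩ : P.ring) ^ q *
          ⟨Y.ratio i P.chart, P.ratio_chart_mem i⟩) := by
  refine congrArg _ (Finset.sum_congr rfl fun i _ => congrArg (· * _) ?_)
  exact Subtype.ext (map_pow _ _ _)

end ModelPoint

end ProjVariety

theorem proposition3p1 {k K : Type*} [Field k] [PerfectField k] [Field K] [Algebra k K]
    [IsAlgClosure k K] (p : ℕ) [Fact p.Prime] [CharP k p] {n : ℕ} (hpn : n < p)
    (Y : ProjCurve K n) (hYk : Y.IsDefinedOver k) (hY : Y.IsNondegenerate)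
    (y : Fin (n + 1) → Y.functionField k) (hy : Y.IsCoordinateFunctions y)
    (r : ℕ) (hr : 0 < r) (u : Fin (n + 1) → Y.functionField k) (hu : u ≠ 0)
    (hrel : ∑ i, u i ^ p ^ r * y i = 0) :
    ∀ᶠ P : Y.ModelPoint in Filter.cofinite,
      ∃ b : Fin (n + 1) → K, b ≠ 0 ∧ (∀ i, P.HasValue (Y.incl k (u i)) (b i)) ∧
        ((p ^ r : ℕ) : ℕ∞) ≤ P.intersectionMultiplicity (fun i => b i ^ p ^ r) ∧
        ∀ (ζ : Y.functionField k) (hζ : IsSeparatingElement k ζ),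
          (P.intersectionMultiplicity (fun i => b i ^ p ^ r) = ((p ^ r : ℕ) : ℕ∞) ↔
            ∑ i, hζ.hasseDeriv (u i) ^ p ^ r * y i ≠ 0) := by
  have : IsAlgClosed K := IsAlgClosure.isAlgClosed k
  have : Algebra.IsAlgebraic k K := IsAlgClosure.isAlgebraic
  have : Algebra.EssFiniteType K (Y.functionField K) := Y.essFiniteType_functionField
  filter_upwards [eventually_addVal_sum_pow_mul Y.trdeg_eq_one
    (ProjVariety.ModelPoint.ring_injective (Y := Y.toProjVariety)) (fun P => P.algebraMap_mem)
    (Y.incl k) (Y.adjoin_range_incl k) p r hy.1 hu hrel] with P ⟨b, hb0, hb, h⟩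
  refine ⟨b, hb0, hb, ?_⟩
  rw [P.intersectionMultiplicity_pow]
  exact h (fun i => ⟨Y.ratio i P.chart, P.ratio_chart_mem i⟩) P.chart
    (hy.incl_eq_mul_ratio P.coord_chart_ne_zero)
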